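/- Let $D\subseteq\mathbb{R}^2$ be open and let $\mathbf F=(F_1,F_2):D\to\mathbb{R}^2$ be a $C^\infty$ (position-dependent) force field, with $\operatorname{curl}\mathbf F=\partial_1F_2-\partial_2F_1$. For an open set $N\subseteq D$, call $C^\infty$ functions $U,V:N\to\mathbb{R}$ \emph{generalized potentials} of $\mathbf F$ on $N$ if $\mathbf F=-V\,\nabla U$ on $N$. (1) Let $x_0\in D$ be a point such that $\mathbf F(x_0)\neq\mathbf 0$, or such that $\operatorname{curl}\mathbf F=0$ in a neighbourhood of $x_0$. Then there are an open neighbourhood $N\subseteq D$ of $x_0$ and generalized potentials $U,V$ of $\mathbf F$ on $N$ such that, for every open $W\subseteq N$ containing $x_0$, $$\operatorname{curl}\mathbf F=0\text{ on }W\iff\nabla V=\mathbf 0\text{ on }W\iff V=f(U)\text{ on }W\text{ for some function }f:\mathbb{R}\to\mathbb{R}.$$ (2) Let $N\subseteq D$ be open and let $U,V$ be any generalized potentials of $\mathbf F$ on $N$. Then: (a) at each $x\in N$, $\operatorname{curl}\mathbf F(x)=0$ if and only if $\nabla U(x)$ and $\nabla V(x)$ are linearly dependent; (b) if $\nabla V=\mathbf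 0$ on $N$, then $\operatorname{curl}\mathbf F=0$ on $N$; (c) if $V=f(U)$ on $N$ for some function $f:\mathbb{R}\to\mathbb{R}$, then $\operatorname{curl}\mathbf F=0$ on $N$; (d) for each $p\in N$ with $\nabla U(p)\neq\mathbf 0$ (in particular whenever $\mathbf F(p)\neq\mathbf 0$), $\operatorname{curl}\mathbf F=0$ in a neighbourhood of $p$ if and only if there is a $C^\infty$ function $f:\mathbb{R}\to\mathbb{R}$ with $V=f(U)$ in a neighbourhood of $p$. -/

import Mathlib

open Filter Topology
open scoped ContDiff Gradient

/-- The Euclidean plane. -/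
abbrev Plane : Type := EuclideanSpace ℝ (Fin 2)

/-- The (scalar) curl `∂F₂/∂x₁ - ∂F₁/∂x₂` of a plane vector field; it is the coefficient of
`dx₁ ∧ dx₂` in the exterior derivative of the work form `F₁ dx₁ + F₂ dx₂`. -/
noncomputable def planeCurl (F : Plane → Plane) (x : Plane) : ℝ :=
  fderiv ℝ F x (EuclideanSpace.single 0 1) 1 - fderiv ℝ F x (EuclideanSpace.single 1 1) 0

/-- `U` and `V` are (smooth) generalized potentials of `F` on the set `N` (meant to be open):
`F = -V ∇U` on `N`. -/
structure IsGeneralizedPotentials (F : Plane → Plane) (N : Set Plane) (U V : Plane → ℝ) :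
    Prop where
  smooth_U : ContDiffOn ℝ ∞ U N
  smooth_V : ContDiffOn ℝ ∞ V N
  eq_neg_smul_gradient : ∀ x ∈ N, F x = -(V x • ∇ U x)

/-! Since gradients have no curl, `F = -V ∇U` gives `curl F = ∂₁U ∂₂V - ∂₂U ∂₁V`, the Jacobian of
`(U, V)` (`planeCurl_eq_det`). This settles (2a) and (2b). If `V = f(U)` with `f` arbitrary, the
image of `(U, V)` lies in a graph, which has empty interior, so the Jacobian vanishes. Conversely,
near a regular point of `U`, a vanishing Jacobian makes `V` constant along the level curves of `U`;
straightening these exhibits `V` as a smooth function of `U`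
(`exists_contDiff_comp_of_det_eq_zero`).

For (1), a field that is curl-free near `x₀` has a potential with `V = 1`, and all three conditions
hold. Otherwise `F x₀ ≠ 0`, and by (2b) and (2c) all three conditions fail on every `W`, so any
generalized potentials serve. Take `U` to be a first integral of `F` rotated by a right angle: then
`∇U` is parallel to `F`, and `V` is read off as a quotient. The first integral comes from a flow box
(`exists_first_integral`). The smooth flow it needs comes from the inverse function theorem, applied
to the integral equation in the space of curves `C([0,1], E)`, where superposition by a smooth map
is smooth. -/

/-! ### Smoothness of superposition operators -/

section Superposition

universe u

variable {K : Type*} [TopologicalSpace K] [CompactSpace K]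

/-- The pointwise application of a continuous family of continuous linear maps, as a continuous
bilinear map. -/
noncomputable def ContinuousMap.pointwiseApply (K : Type*) [TopologicalSpace K] [CompactSpace K]
    (E F : Type*) [NormedAddCommGroup E] [NormedSpace ℝ E]
    [NormedAddCommGroup F] [NormedSpace ℝ F] :
    C(K, E →L[ℝ] F) →L[ℝ] C(K, E) →L[ℝ] C(K, F) :=
  LinearMap.mkContinuous₂
    (LinearMap.mk₂ ℝ (fun (A : C(K, E →L[ℝ] F)) (h : C(K, E)) => (⟨fun s => A s (h s), by fun_prop⟩ : C(K, F)))
      (fun A B h => by ext s; simp) (fun c A h => by ext s; simp)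
      (fun A h k => by ext s; simp) (fun c A h => by ext s; simp))
    1 (fun A h => by
      rw [one_mul, ContinuousMap.norm_le _ (by positivity)]
      intro s
      exact (A s).le_of_opNorm_le_of_le (A.norm_coe_le_norm s) (h.norm_coe_le_norm s))

@[simp]
theorem ContinuousMap.pointwiseApply_apply {E F : Type*} [NormedAddCommGroup E] [NormedSpace ℝ E]
    [NormedAddCommGroup F] [NormedSpace ℝ F] (A : C(K, E →L[ℝ] F)) (h : C(K, E)) (s : K) :
    ContinuousMap.pointwiseApply K E F A h s = A s (h s) := rfl

theorem ContinuousMap.hasFDerivAt_comp_left {E F : Type*} [NormedAddCommGroup E] [NormedSpace ℝ E]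
    [NormedAddCommGroup F] [NormedSpace ℝ F] (G : C(E, F)) (G' : C(E, E →L[ℝ] F))
    (hG : ∀ x, HasFDerivAt G (G' x) x) (w : C(K, E)) :
    HasFDerivAt (fun w : C(K, E) => G.comp w)
      (ContinuousMap.pointwiseApply K E F (G'.comp w)) w := by
  rw [hasFDerivAt_iff_isLittleO_nhds_zero, Asymptotics.isLittleO_iff]
  intro ε hε
  have hcont : ContinuousAt (fun w : C(K, E) => G'.comp w) w :=
    (ContinuousMap.continuous_postcomp G').continuousAt
  obtain ⟨δ, hδ, hδ'⟩ := (Metric.continuousAt_iff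
    (f := fun w : C(K, E) => G'.comp w) (a := w)).1 hcont ε hε
  filter_upwards [Metric.ball_mem_nhds (0 : C(K, E)) hδ] with h hh
  rw [mem_ball_zero_iff] at hh
  rw [ContinuousMap.norm_le _ (by positivity)]
  intro s
  -- Mean value inequality for `G - G' (w s)`. Shifting `w` by a constant turns continuity in the
  -- sup norm into a bound at the point `x`, with `δ` independent of `s`.
  have key := (convex_ball (w s) δ).norm_image_sub_le_of_norm_hasFDerivWithin_le'
    (f := G) (f' := G') (φ := G' (w s)) (C := ε) (x := w s) (y := w s + h s)
    (fun x _ => (hG x).hasFDerivWithinAt) (fun x hx => by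
      have h1 : dist (w + ContinuousMap.const K (x - w s)) w < δ := by
        rw [dist_eq_norm, add_sub_cancel_left]
        refine lt_of_le_of_lt ((ContinuousMap.norm_le _ (norm_nonneg (x - w s))).2
          fun _ => le_rfl) ?_
        rwa [← dist_eq_norm]
      have h2 := (ContinuousMap.dist_apply_le_dist s).trans (hδ' h1).le
      simpa [dist_eq_norm] using h2)
    (Metric.mem_ball_self hδ) (by
      rw [mem_ball_iff_norm, add_sub_cancel_left]
      exact (h.norm_coe_le_norm s).trans_lt hh)
  rw [add_sub_cancel_left] at key
  refine le_trans ?_ (key.trans (mul_le_mul_of_nonneg_left (h.norm_coe_le_norm s) hε.le))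
  simp

/-- The derivative is again a superposition operator, by `fderiv ℝ G`, followed by a continuous
linear map. The induction replaces `F` by `E →L[ℝ] F`, hence the common universe. -/
theorem ContinuousMap.contDiff_comp_left_nat {E : Type u} [NormedAddCommGroup E] [NormedSpace ℝ E]
    (n : ℕ) : ∀ {F : Type u} [NormedAddCommGroup F] [NormedSpace ℝ F] (G : C(E, F)),
      ContDiff ℝ n G → ContDiff ℝ n (fun w : C(K, E) => G.comp w) := by
  induction n with
  | zero =>
    intro F _ _ G _
    exact contDiff_zero.2 (ContinuousMap.continuous_postcomp G)
  | succ n ih =>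
    intro F _ _ G hG
    have hG' := hG
    push_cast at hG' ⊢
    rw [contDiff_succ_iff_fderiv] at hG'
    let G' : C(E, E →L[ℝ] F) := ⟨fderiv ℝ G, hG'.2.2.continuous⟩
    have hd := fun w : C(K, E) => ContinuousMap.hasFDerivAt_comp_left G G'
      (fun x => (hG'.1 x).hasFDerivAt) w
    rw [contDiff_succ_iff_fderiv]
    refine ⟨fun w => (hd w).differentiableAt, by simp, ?_⟩
    rw [funext fun w => (hd w).fderiv]
    exact (ContinuousMap.pointwiseApply K E F).contDiff.comp (ih G' hG'.2.2)

/-- Composition on the left with a smooth map is a smooth map between spaces of continuous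
functions on a compact space. -/
theorem ContinuousMap.contDiff_comp_left {E F : Type u} [NormedAddCommGroup E] [NormedSpace ℝ E]
    [NormedAddCommGroup F] [NormedSpace ℝ F] (G : C(E, F)) (hG : ContDiff ℝ ∞ G) :
    ContDiff ℝ ∞ (fun w : C(K, E) => G.comp w) :=
  contDiff_infty.2 fun n => ContinuousMap.contDiff_comp_left_nat n G (contDiff_infty.1 hG n)

end Superposition

/-! ### The integration operator on curves -/

section Flow

open Set

variable {E : Type*} [NormedAddCommGroup E] [NormedSpace ℝ E]

/-- Integration from `0`, as a continuous linear operator on the curves over the unit interval. -/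
noncomputable def unitIntervalPrimitive (E : Type*) [NormedAddCommGroup E] [NormedSpace ℝ E] :
    C(Icc (0 : ℝ) 1, E) →L[ℝ] C(Icc (0 : ℝ) 1, E) :=
  LinearMap.mkContinuous
    { toFun := fun y => ⟨fun s => ∫ r in (0 : ℝ)..s, y (projIcc 0 1 zero_le_one r),
        (intervalIntegral.continuous_primitive (fun a b => Continuous.intervalIntegrable
          (by fun_prop) a b) 0).comp continuous_subtype_val⟩
      map_add' := fun y z => by
        ext s
        exact intervalIntegral.integral_add (Continuous.intervalIntegrable (by fun_prop) _ _)
          (Continuous.intervalIntegrable (by fun_prop) _ _)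
      map_smul' := fun c y => by
        ext s
        exact intervalIntegral.integral_smul c _ }
    1 (fun y => by
      rw [one_mul, ContinuousMap.norm_le _ (norm_nonneg y)]
      intro s
      refine (intervalIntegral.norm_integral_le_of_norm_le_const
        (C := ‖y‖) fun r _ => y.norm_coe_le_norm _).trans ?_
      rw [sub_zero, abs_of_nonneg s.2.1]
      exact mul_le_of_le_one_right (norm_nonneg y) s.2.2)

theorem unitIntervalPrimitive_apply (y : C(Icc (0 : ℝ) 1, E)) (s : Icc (0 : ℝ) 1) :
    unitIntervalPrimitive E y s = ∫ r in (0 : ℝ)..s, y (projIcc 0 1 zero_le_one r) := rfl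

end Flow

/-! ### The smooth inverse function theorem -/

section InverseFunction

variable {E F : Type*} [NormedAddCommGroup E] [NormedSpace ℝ E] [CompleteSpace E]
  [NormedAddCommGroup F] [NormedSpace ℝ F]

/-- The inverse function theorem, with smoothness of both directions on whole neighbourhoods. -/
theorem exists_openPartialHomeomorph_contDiffAt {f : E → F} {a : E}
    (hf : ∀ᶠ x in 𝓝 a, ContDiffAt ℝ ∞ f x) {f' : E ≃L[ℝ] F}
    (hf' : HasFDerivAt f (f' : E →L[ℝ] F) a) :
    ∃ e : OpenPartialHomeomorph E F, (e : E → F) = f ∧ a ∈ e.source ∧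
      (∀ x ∈ e.source, ContDiffAt ℝ ∞ f x) ∧ ∀ y ∈ e.target, ContDiffAt ℝ ∞ e.symm y := by
  have hn : (∞ : WithTop ℕ∞) ≠ 0 := by simp
  have hfa := hf.self_of_nhds
  have hcont : ContinuousAt (fderiv ℝ f) a :=
    (hfa.fderiv_right (m := 0) (by simp)).continuousAt
  -- Invertibility of the derivative is an open condition; restricting to it makes the inverse
  -- smooth on the whole target.
  have hequiv : ∀ᶠ x in 𝓝 a, fderiv ℝ f x ∈
      Set.range ((↑) : (E ≃L[ℝ] F) → E →L[ℝ] F) :=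
    hcont.eventually (by rw [hf'.fderiv]; exact ContinuousLinearEquiv.nhds f')
  obtain ⟨t, ht, hto, hat⟩ := mem_nhds_iff.1 (hf.and hequiv)
  let e := (hfa.toOpenPartialHomeomorph f hf' hn).restrOpen t hto
  have hes : ∀ x ∈ e.source, x ∈ t := fun x hx => hx.2
  refine ⟨e, rfl, ⟨hfa.mem_toOpenPartialHomeomorph_source hf' hn, hat⟩,
    fun x hx => (ht (hes x hx)).1, fun y hy => ?_⟩
  have hx := ht (hes _ (e.map_target hy))
  obtain ⟨f'', hf''⟩ := hx.2
  refine e.contDiffAt_symm hy (f₀' := f'') ?_ hx.1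
  rw [hf'']
  exact (hx.1.differentiableAt hn).hasFDerivAt

end InverseFunction

/-! ### Smooth local flows -/

section LocalFlow

open Set

variable {E : Type*} [NormedAddCommGroup E] [NormedSpace ℝ E]

/-- The rescaling `s ↦ y (r * s)` of a curve `y` over the unit interval. -/
def rescaleCurve {E : Type*} [TopologicalSpace E] (r : Icc (0 : ℝ) 1)
    (y : C(Icc (0 : ℝ) 1, E)) : C(Icc (0 : ℝ) 1, E) where
  toFun s := y ⟨r * s, mul_nonneg r.2.1 s.2.1, mul_le_one₀ r.2.2 s.2.1 s.2.2⟩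
  continuous_toFun := by fun_prop

theorem dist_rescaleCurve_const_le {E : Type*} [NormedAddCommGroup E]
    (r : Icc (0 : ℝ) 1) (y : C(Icc (0 : ℝ) 1, E)) (x : E) :
    dist (rescaleCurve r y) (ContinuousMap.const _ x) ≤ dist y (ContinuousMap.const _ x) :=
  (ContinuousMap.dist_le dist_nonneg).2 fun s =>
    ContinuousMap.dist_apply_le_dist (f := y) (g := ContinuousMap.const _ x)
      ⟨r * s, mul_nonneg r.2.1 s.2.1, mul_le_one₀ r.2.2 s.2.1 s.2.2⟩

theorem smul_unitIntervalPrimitive_rescaleCurve (r : Icc (0 : ℝ) 1) (y : C(Icc (0 : ℝ) 1, E)) :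
    (r : ℝ) • unitIntervalPrimitive E (rescaleCurve r y) =
      rescaleCurve r (unitIntervalPrimitive E y) := by
  ext s
  have hs : (r : ℝ) * s ∈ Icc (0 : ℝ) 1 :=
    ⟨mul_nonneg r.2.1 s.2.1, mul_le_one₀ r.2.2 s.2.1 s.2.2⟩
  have h1 := intervalIntegral.smul_integral_comp_mul_left
    (fun τ => y (projIcc 0 1 zero_le_one τ)) (r : ℝ) (a := 0) (b := s)
  rw [mul_zero] at h1
  change (r : ℝ) • unitIntervalPrimitive E (rescaleCurve r y) s =
    unitIntervalPrimitive E y ⟨r * s, hs⟩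
  rw [unitIntervalPrimitive_apply, unitIntervalPrimitive_apply, ← h1]
  congr 1
  refine intervalIntegral.integral_congr fun σ hσ => ?_
  rw [uIcc_of_le s.2.1] at hσ
  have hσ1 : σ ∈ Icc (0 : ℝ) 1 := ⟨hσ.1, hσ.2.trans s.2.2⟩
  have hrσ : (r : ℝ) * σ ∈ Icc (0 : ℝ) 1 :=
    ⟨mul_nonneg r.2.1 hσ1.1, mul_le_one₀ r.2.2 hσ1.1 hσ1.2⟩
  simp only [rescaleCurve, ContinuousMap.coe_mk, projIcc_of_mem _ hσ1, projIcc_of_mem _ hrσ]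

/-- The integral equation `y s = x + t ∫₀ˢ v (y r) dr` on curves over the unit interval, written
as the vanishing of its defect. -/
noncomputable def flowDefect (v : C(E, E)) (u : (ℝ × E) × C(Icc (0 : ℝ) 1, E)) :
    C(Icc (0 : ℝ) 1, E) :=
  u.2 - ContinuousMap.const _ u.1.2 - u.1.1 • unitIntervalPrimitive E (v.comp u.2)

theorem contDiff_continuousMapConst {K : Type*} [TopologicalSpace K] [CompactSpace K] :
    ContDiff ℝ ∞ (fun x : E => ContinuousMap.const K x) :=
  (LinearMap.mkContinuous (E := E) (F := C(K, E)) (σ := RingHom.id ℝ)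
    { toFun := fun x => ContinuousMap.const K x
      map_add' := fun _ _ => rfl
      map_smul' := fun _ _ => rfl } 1 fun x => by
        rw [one_mul]
        exact (ContinuousMap.norm_le _ (norm_nonneg x)).2 fun _ => le_rfl).contDiff

theorem contDiff_flowDefect {v : C(E, E)} (hv : ContDiff ℝ ∞ v) :
    ContDiff ℝ ∞ (flowDefect v) := by
  have h1 : ContDiff ℝ ∞ (fun u : (ℝ × E) × C(Icc (0 : ℝ) 1, E) =>
      ContinuousMap.const (Icc (0 : ℝ) 1) u.1.2) :=
    contDiff_continuousMapConst.comp (contDiff_snd.comp contDiff_fst)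
  have h2 : ContDiff ℝ ∞ (fun u : (ℝ × E) × C(Icc (0 : ℝ) 1, E) =>
      unitIntervalPrimitive E (v.comp u.2)) :=
    (unitIntervalPrimitive E).contDiff.comp
      ((ContinuousMap.contDiff_comp_left v hv).comp contDiff_snd)
  exact (contDiff_snd.sub h1).sub ((contDiff_fst.comp contDiff_fst).smul h2)

/-- Slowing a solution down by the factor `r` solves the equation for time `r * t`. With local
uniqueness, this lets the endpoints `s = 1` determine the whole curve. -/
theorem flowDefect_rescaleCurve {v : C(E, E)} {t : ℝ} {x : E} {y : C(Icc (0 : ℝ) 1, E)}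
    (h : flowDefect v ((t, x), y) = 0) (r : Icc (0 : ℝ) 1) :
    flowDefect v ((r * t, x), rescaleCurve r y) = 0 := by
  have h1 : ((r : ℝ) * t) • unitIntervalPrimitive E (v.comp (rescaleCurve r y)) =
      t • rescaleCurve r (unitIntervalPrimitive E (v.comp y)) := by
    rw [← smul_unitIntervalPrimitive_rescaleCurve, smul_smul, mul_comm t]
    rfl
  have h2 : flowDefect v ((r * t, x), rescaleCurve r y) =
      rescaleCurve r (flowDefect v ((t, x), y)) := by
    simp only [flowDefect, h1]
    rfl
  rw [h2, h]
  rfl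

/-- Smooth dependence of the solutions of an autonomous differential equation on time and on the
initial value. -/
theorem exists_contDiffAt_localFlow [CompleteSpace E] {v : E → E} (hv : ContDiff ℝ ∞ v) (x₀ : E) :
    ∃ φ : ℝ × E → E, ∀ᶠ p in 𝓝 ((0, x₀) : ℝ × E),
      ContDiffAt ℝ ∞ φ p ∧ φ (0, p.2) = p.2 ∧ HasDerivAt (fun t => φ (t, p.2)) (v (φ p)) p.1 := by
  let vC : C(E, E) := ⟨v, hv.continuous⟩
  let c₀ : C(Icc (0 : ℝ) 1, E) := ContinuousMap.const _ x₀
  let u₀ : (ℝ × E) × C(Icc (0 : ℝ) 1, E) := ((0, x₀), c₀)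
  have hf : ContDiff ℝ ∞ (flowDefect vC) := contDiff_flowDefect (v := vC) hv
  have hf0 : flowDefect vC u₀ = 0 := by simp [flowDefect, u₀, c₀]
  let A := fderiv ℝ (flowDefect vC) u₀
  -- At `t = 0` the integral term drops out, so the partial derivative in the curve is the identity,
  -- and the derivative of `(u.1, flowDefect vC u)` is block triangular with an explicit inverse.
  have hA : ∀ k, A (0, k) = k := by
    have h1 : HasFDerivAt (fun y : C(Icc (0 : ℝ) 1, E) => flowDefect vC ((0, x₀), y))
        (A ∘L .inr ℝ (ℝ × E) C(Icc (0 : ℝ) 1, E)) c₀ :=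
      (hf.contDiffAt.differentiableAt (by simp)).hasFDerivAt.comp c₀
        (hasFDerivAt_prodMk_right (0, x₀) c₀)
    have h2 : HasFDerivAt (fun y : C(Icc (0 : ℝ) 1, E) => flowDefect vC ((0, x₀), y))
        (ContinuousLinearMap.id ℝ _) c₀ := by
      simpa [flowDefect] using (hasFDerivAt_id c₀).sub_const (ContinuousMap.const _ x₀)
    exact fun k => DFunLike.congr_fun (h1.unique h2) k
  have hA' : ∀ h k, A (h, k) = A (h, 0) + k := by
    intro h k
    have h1 := map_add A (h, 0) (0, k)
    rw [hA, Prod.mk_add_mk, add_zero, zero_add] at h1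
    exact h1
  let Ψ' : ((ℝ × E) × C(Icc (0 : ℝ) 1, E)) ≃L[ℝ] ((ℝ × E) × C(Icc (0 : ℝ) 1, E)) :=
    ContinuousLinearEquiv.equivOfInverse ((ContinuousLinearMap.fst ℝ _ _).prod A)
      ((ContinuousLinearMap.fst ℝ _ _).prod
        (ContinuousLinearMap.snd ℝ _ _ - A ∘L .inl ℝ _ _ ∘L ContinuousLinearMap.fst ℝ _ _))
      (fun u => by
        refine Prod.ext rfl ?_
        change A (u.1, u.2) - A (u.1, 0) = u.2
        rw [hA', add_sub_cancel_left])
      (fun u => by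
        refine Prod.ext rfl ?_
        change A (u.1, u.2 - A (u.1, 0)) = u.2
        rw [hA', add_sub_cancel])
  have hΨ : ContDiff ℝ ∞ (fun u => (u.1, flowDefect vC u)) := contDiff_fst.prodMk hf
  have hΨ' : HasFDerivAt (fun u => (u.1, flowDefect vC u))
      (Ψ' : ((ℝ × E) × C(Icc (0 : ℝ) 1, E)) →L[ℝ] ((ℝ × E) × C(Icc (0 : ℝ) 1, E))) u₀ :=
    hasFDerivAt_fst.prodMk (hf.contDiffAt.differentiableAt (by simp)).hasFDerivAt
  obtain ⟨e, he, heu, -, hes⟩ := exists_openPartialHomeomorph_contDiffAt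
    (Eventually.of_forall fun _ => hΨ.contDiffAt) hΨ'
  have heq : ∀ u, e u = (u.1, flowDefect vC u) := fun u => congrFun he u
  let Y : ℝ × E → C(Icc (0 : ℝ) 1, E) := fun p => (e.symm (p, 0)).2
  have hiff' : ∀ u ∈ e.source, flowDefect vC u = 0 → Y u.1 = u.2 := by
    intro u hu hu0
    have h1 := e.left_inv hu
    rw [heq, hu0] at h1
    exact congrArg Prod.snd h1
  have htarget : ∀ᶠ p in 𝓝 ((0, x₀) : ℝ × E), (p, 0) ∈ e.target := by
    have h1 : ContinuousAt (fun p : ℝ × E => (p, (0 : C(Icc (0 : ℝ) 1, E)))) (0, x₀) := by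
      fun_prop
    refine h1.eventually (e.open_target.mem_nhds ?_)
    have := e.map_source heu
    rwa [heq, hf0] at this
  have hYs' : ∀ p : ℝ × E, (p, 0) ∈ e.target → ContDiffAt ℝ ∞ Y p := fun p hp =>
    contDiffAt_snd.comp p ((hes _ hp).comp p (contDiffAt_id.prodMk contDiffAt_const))
  have hY0 : Y (0, x₀) = c₀ := hiff' u₀ heu hf0
  have hYe : ∀ᶠ p in 𝓝 ((0, x₀) : ℝ × E), flowDefect vC (p, Y p) = 0 := by
    filter_upwards [htarget] with p hp
    have h1 := e.right_inv hp
    rw [heq, Prod.ext_iff] at h1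
    have h2 : e.symm (p, 0) = (p, Y p) := Prod.ext h1.1 rfl
    rw [← h2]
    exact h1.2
  obtain ⟨δ, hδ, hiff⟩ := Metric.eventually_nhds_iff_ball.1 (e.open_source.mem_nhds heu)
  let one : Icc (0 : ℝ) 1 := ⟨1, zero_le_one, le_rfl⟩
  have hdist : ∀ᶠ p in 𝓝 ((0, x₀) : ℝ × E), dist (Y p) c₀ < δ := by
    have := (hYs' _ htarget.self_of_nhds).continuousAt.eventually (Metric.ball_mem_nhds _ hδ)
    simpa [hY0] using this
  obtain ⟨η, hη, hball⟩ := Metric.eventually_nhds_iff_ball.1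
    (hYe.and (hdist.and ((htarget.mono hYs').and (Metric.ball_mem_nhds ((0, x₀) : ℝ × E) hδ))))
  have hmem : ∀ {t : ℝ} {x : E}, (t, x) ∈ Metric.ball ((0, x₀) : ℝ × E) η ↔
      |t| < η ∧ dist x x₀ < η := by
    intro t x
    simp [Prod.dist_eq]
  -- Both sides come from solutions close to `c₀` for the same data, so uniqueness identifies them.
  -- This turns the equation in `s` into an integral equation in `t` for the endpoint.
  have hscale : ∀ {t : ℝ} {x : E}, (t, x) ∈ Metric.ball ((0, x₀) : ℝ × E) η →
      ∀ r : Icc (0 : ℝ) 1, Y (r * t, x) one = Y (t, x) r := by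
    intro t x hp r
    have hp' : ((r : ℝ) * t, x) ∈ Metric.ball ((0, x₀) : ℝ × E) η := by
      rw [hmem] at hp ⊢
      refine ⟨lt_of_le_of_lt ?_ hp.1, hp.2⟩
      rw [abs_mul, abs_of_nonneg r.2.1]
      exact mul_le_of_le_one_left (abs_nonneg t) r.2.2
    have h1 := flowDefect_rescaleCurve ((hball _ hp).1) r
    have h2 := hiff' _ (hiff (((r : ℝ) * t, x), rescaleCurve r (Y (t, x))) (by
      rw [Metric.mem_ball, Prod.dist_eq, max_lt_iff]
      exact ⟨(hball _ hp').2.2.2,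
        (dist_rescaleCurve_const_le r _ _).trans_lt (hball _ hp).2.1⟩)) h1
    refine (DFunLike.congr_fun h2 one).trans ?_
    simp [rescaleCurve, one]
  have hint : ∀ {t : ℝ} {x : E}, (t, x) ∈ Metric.ball ((0, x₀) : ℝ × E) η →
      Y (t, x) one = x + ∫ τ in (0 : ℝ)..t, v (Y (τ, x) one) := by
    intro t x hp
    have h1 := DFunLike.congr_fun ((hball _ hp).1) one
    have h2 : Y (t, x) one - x -
        t • ∫ r in (0 : ℝ)..1, v (Y (t, x) (projIcc 0 1 zero_le_one r)) = 0 := h1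
    have h3 : ∫ r in (0 : ℝ)..1, v (Y (t, x) (projIcc 0 1 zero_le_one r)) =
        ∫ r in (0 : ℝ)..1, v (Y (r * t, x) one) := by
      refine intervalIntegral.integral_congr fun r hr => ?_
      rw [uIcc_of_le zero_le_one] at hr
      simp only [projIcc_of_mem _ hr]
      rw [← hscale hp ⟨r, hr⟩]
    rw [h3, intervalIntegral.smul_integral_comp_mul_right (fun τ => v (Y (τ, x) one)) t,
      zero_mul, one_mul, sub_sub, sub_eq_zero] at h2
    exact h2
  refine ⟨fun p => Y p one, ?_⟩
  filter_upwards [Metric.ball_mem_nhds _ hη]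
  rintro ⟨t, x⟩ hp
  have hx := (hmem.1 hp).2
  refine ⟨?_, ?_, ?_⟩
  · exact ((ContinuousMap.evalCLM ℝ one :
      C(Icc (0 : ℝ) 1, E) →L[ℝ] E).contDiff (n := ∞)).contDiffAt.comp (t, x) (hball _ hp).2.2.1
  · have := hint (t := 0) (x := x) (hmem.2 ⟨by simpa using hη, hx⟩)
    simpa using this
  · have hc : ContinuousOn (fun τ => v (Y (τ, x) one)) (Ioo (-η) η) := by
      intro τ hτ
      have h1 : ContinuousAt Y (τ, x) := (hball _ (hmem.2 ⟨abs_lt.2 hτ, hx⟩)).2.2.1.continuousAt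
      have h2 : ContinuousAt (fun τ : ℝ => Y (τ, x)) τ :=
        ContinuousAt.comp (g := Y) h1 (by fun_prop)
      exact (hv.continuous.continuousAt.comp
        ((ContinuousMap.evalCLM ℝ one).continuous.continuousAt.comp h2)).continuousWithinAt
    have ht : t ∈ Ioo (-η) η := abs_lt.1 (hmem.1 hp).1
    have h0 : (0 : ℝ) ∈ Ioo (-η) η := ⟨by linarith, hη⟩
    have hd := intervalIntegral.integral_hasDerivAt_right
      ((hc.mono (ordConnected_Ioo.uIcc_subset h0 ht)).intervalIntegrable (a := 0) (b := t))
      (hc.stronglyMeasurableAtFilter isOpen_Ioo t ht) (hc.continuousAt (isOpen_Ioo.mem_nhds ht))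
    refine (hd.const_add x).congr_of_eventuallyEq ?_
    filter_upwards [isOpen_Ioo.mem_nhds ht] with τ hτ
    exact hint (hmem.2 ⟨abs_lt.2 hτ, hx⟩)

end LocalFlow

/-! ### Cut-offs and linear algebra in the plane -/

/-- A function that is smooth near a point agrees near that point with a globally smooth one. -/
theorem exists_contDiff_eventuallyEq {E F : Type*} [NormedAddCommGroup E] [NormedSpace ℝ E]
    [HasContDiffBump E] [NormedAddCommGroup F] [NormedSpace ℝ F] {f : E → F} {x₀ : E}
    (hf : ∀ᶠ x in 𝓝 x₀, ContDiffAt ℝ ∞ f x) :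
    ∃ g : E → F, ContDiff ℝ ∞ g ∧ g =ᶠ[𝓝 x₀] f := by
  obtain ⟨r, hr, hball⟩ := Metric.eventually_nhds_iff_ball.1 hf
  let χ : ContDiffBump x₀ := ⟨r / 4, r / 2, by positivity, by linarith⟩
  refine ⟨fun x => χ x • f x, contDiff_iff_contDiffAt.2 fun y => ?_, ?_⟩
  · by_cases hy : y ∈ Metric.ball x₀ r
    · exact χ.contDiffAt.smul (hball y hy)
    · have h1 : y ∉ tsupport χ := by
        rw [χ.tsupport_eq, Metric.mem_closedBall]
        rw [Metric.mem_ball] at hy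
        have : χ.rOut = r / 2 := rfl
        linarith
      have h2 : (fun x => χ x • f x) =ᶠ[𝓝 y] fun _ => 0 := by
        filter_upwards [notMem_tsupport_iff_eventuallyEq.1 h1] with x hx
        simp [hx]
      exact contDiffAt_const.congr_of_eventuallyEq h2
  · filter_upwards [χ.eventuallyEq_one] with x hx
    simp [hx]

theorem ContinuousLinearMap.exists_equiv_of_injective {E F : Type*} [NormedAddCommGroup E]
    [NormedSpace ℝ E] [FiniteDimensional ℝ E] [NormedAddCommGroup F] [NormedSpace ℝ F]
    [FiniteDimensional ℝ F] (A : E →L[ℝ] F) (hA : ∀ x, A x = 0 → x = 0)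
    (hdim : Module.finrank ℝ E = Module.finrank ℝ F) :
    ∃ e : E ≃L[ℝ] F, (e : E →L[ℝ] F) = A := by
  have hinj : Function.Injective (A : E →ₗ[ℝ] F) :=
    (injective_iff_map_eq_zero (A : E →ₗ[ℝ] F)).2 hA
  exact ⟨(LinearEquiv.ofInjectiveOfFinrankEq (A : E →ₗ[ℝ] F) hinj hdim).toContinuousLinearEquiv,
    by ext x; rfl⟩

/-- The rotation of a plane vector by a right angle. -/
noncomputable def planeRotate (w : Plane) : Plane := !₂[-w 1, w 0]

@[simp] theorem planeRotate_zero (w : Plane) : planeRotate w 0 = -w 1 := rfl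
@[simp] theorem planeRotate_one (w : Plane) : planeRotate w 1 = w 0 := rfl

theorem contDiff_planeRotate : ContDiff ℝ ∞ planeRotate := by
  rw [contDiff_euclidean]
  intro i
  fin_cases i
  · exact (contDiff_euclidean.1 contDiff_id 1).neg
  · exact contDiff_euclidean.1 contDiff_id 0

theorem sq_add_sq_pos_of_ne_zero {w : Plane} (hw : w ≠ 0) : 0 < w 0 ^ 2 + w 1 ^ 2 := by
  by_contra! h
  refine hw (PiLp.ext fun i => ?_)
  have h0 : w 0 = 0 := by nlinarith [sq_nonneg (w 0), sq_nonneg (w 1)]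
  have h1 : w 1 = 0 := by nlinarith [sq_nonneg (w 0), sq_nonneg (w 1)]
  fin_cases i
  · exact h0
  · exact h1

theorem planeRotate_ne_zero {w : Plane} (hw : w ≠ 0) : planeRotate w ≠ 0 := by
  intro h
  have h0 := congrArg (fun z : Plane => z 0) h
  have h1 := congrArg (fun z : Plane => z 1) h
  simp only [planeRotate_zero, planeRotate_one, PiLp.zero_apply, neg_eq_zero] at h0 h1
  have := sq_add_sq_pos_of_ne_zero hw
  simp [h0, h1] at this

/-! ### First integrals -/

/-- A smooth plane vector field has a smooth first integral without critical points near every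
point at which it does not vanish. -/
theorem exists_first_integral {v : Plane → Plane} {x₀ : Plane}
    (hv : ∀ᶠ x in 𝓝 x₀, ContDiffAt ℝ ∞ v x) (hv0 : v x₀ ≠ 0) :
    ∃ U : Plane → ℝ, ∀ᶠ x in 𝓝 x₀,
      ContDiffAt ℝ ∞ U x ∧ fderiv ℝ U x ≠ 0 ∧ fderiv ℝ U x (v x) = 0 := by
  obtain ⟨g, hg, hgv⟩ := exists_contDiff_eventuallyEq hv
  obtain ⟨φ, hφ⟩ := exists_contDiffAt_localFlow hg x₀
  -- Initial points run along the line through `x₀` orthogonal to `v x₀`; `U` will be the label of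
  -- the trajectory through a point.
  set n := planeRotate (v x₀) with hn
  let L : ℝ × ℝ → ℝ × Plane := fun p => (p.1, x₀ + p.2 • n)
  have hL : ContDiff ℝ ∞ L := by fun_prop
  have hL0 : L (0, 0) = (0, x₀) := by simp [L]
  have hφL : ∀ᶠ p in 𝓝 ((0, 0) : ℝ × ℝ), ContDiffAt ℝ ∞ φ (L p) ∧ φ (0, (L p).2) = (L p).2 ∧
      HasDerivAt (fun t => φ (t, (L p).2)) (g (φ (L p))) (L p).1 := by
    refine (hL.continuous.tendsto' _ _ hL0).eventually hφ
  let ψ : ℝ × ℝ → Plane := fun p => φ (L p)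
  have hψ : ∀ᶠ p in 𝓝 ((0, 0) : ℝ × ℝ), ContDiffAt ℝ ∞ ψ p :=
    hφL.mono fun p hp => hp.1.comp p hL.contDiffAt
  have hψ0 : ψ (0, 0) = x₀ := by
    have := hφL.self_of_nhds.2.1
    rw [hL0] at this
    simpa [ψ, hL0] using this
  let A := fderiv ℝ ψ (0, 0)
  have hA : HasFDerivAt ψ A (0, 0) :=
    (hψ.self_of_nhds.differentiableAt (by simp)).hasFDerivAt
  have hA1 : A (1, 0) = v x₀ := by
    have h1 : HasDerivAt (fun t : ℝ => ψ (t, 0)) (A (1, 0)) 0 :=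
      HasFDerivAt.comp_hasDerivAt (f := fun t : ℝ => (t, (0 : ℝ))) 0 hA
        ((hasDerivAt_id (0 : ℝ)).prodMk (hasDerivAt_const (0 : ℝ) (0 : ℝ)))
    have h2 := hφL.self_of_nhds.2.2
    change HasDerivAt (fun t : ℝ => ψ (t, 0)) (g (ψ (0, 0))) 0 at h2
    rw [h1.unique h2, hψ0, hgv.self_of_nhds]
  have hA2 : A (0, 1) = n := by
    have h1 : HasDerivAt (fun c : ℝ => ψ (0, c)) (A (0, 1)) 0 :=
      hA.comp_hasDerivAt (0 : ℝ) ((hasDerivAt_const _ _).prodMk (hasDerivAt_id _))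
    have h2 : HasDerivAt (fun c : ℝ => x₀ + c • n) n 0 := by
      simpa using ((hasDerivAt_id (0 : ℝ)).smul_const n).const_add x₀
    refine h1.unique (h2.congr_of_eventuallyEq ?_)
    have h3 : Tendsto (fun c : ℝ => ((0 : ℝ), c)) (𝓝 0) (𝓝 (0, 0)) :=
      Continuous.tendsto' (by fun_prop) _ _ rfl
    filter_upwards [h3.eventually hφL] with c hc
    exact hc.2.1
  have hAinj : ∀ p, A p = 0 → p = 0 := by
    rintro ⟨a, b⟩ hab
    have h1 : A (a, b) = a • v x₀ + b • n := by
      rw [← hA1, ← hA2, ← map_smul, ← map_smul, ← map_add]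
      simp
    rw [h1] at hab
    have h0 := congrArg (fun z : Plane => z 0) hab
    have h1 := congrArg (fun z : Plane => z 1) hab
    simp only [PiLp.add_apply, PiLp.smul_apply, PiLp.zero_apply, smul_eq_mul, hn,
      planeRotate_zero, planeRotate_one] at h0 h1
    have hpos := (sq_add_sq_pos_of_ne_zero hv0).ne'
    have ha : a = 0 := by
      refine (mul_eq_zero.1 (?_ : a * (v x₀ 0 ^ 2 + v x₀ 1 ^ 2) = 0)).resolve_right hpos
      linear_combination v x₀ 0 * h0 + v x₀ 1 * h1
    have hb : b = 0 := by
      refine (mul_eq_zero.1 (?_ : b * (v x₀ 0 ^ 2 + v x₀ 1 ^ 2) = 0)).resolve_right hpos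
      linear_combination v x₀ 0 * h1 - v x₀ 1 * h0
    rw [ha, hb]
    rfl
  obtain ⟨A', hA'⟩ := A.exists_equiv_of_injective hAinj (by simp)
  obtain ⟨e, he, hes, hec, hec'⟩ :=
    exists_openPartialHomeomorph_contDiffAt hψ (f' := A') (by rw [hA']; exact hA)
  have hx₀ : x₀ ∈ e.target := by
    have := e.map_source hes
    rwa [he, hψ0] at this
  have hx₀' : e.symm x₀ = (0, 0) := by
    have := e.left_inv hes
    rwa [he, hψ0] at this
  let U : Plane → ℝ := fun x => (e.symm x).2
  have hU : ∀ x ∈ e.target, ContDiffAt ℝ ∞ U x := fun x hx => contDiffAt_snd.comp x (hec' x hx)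
  refine ⟨U, ?_⟩
  have hback : ∀ᶠ x in 𝓝 x₀, HasDerivAt (fun t => ψ (t, (e.symm x).2)) (g (ψ (e.symm x)))
      (e.symm x).1 := by
    have h1 := (hec' x₀ hx₀).continuousAt
    rw [ContinuousAt, hx₀'] at h1
    exact h1.eventually (hφL.mono fun p hp => hp.2.2)
  filter_upwards [hback, hgv, e.open_target.mem_nhds hx₀] with x hx hgx hxt
  have hψx : ψ (e.symm x) = x := by
    have := e.right_inv hxt
    rwa [he] at this
  have hUd : HasFDerivAt U (fderiv ℝ U x) (ψ (e.symm x)) := by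
    rw [hψx]
    exact ((hU x hxt).differentiableAt (by simp)).hasFDerivAt
  have hUψ : ∀ᶠ p in 𝓝 (e.symm x), U (ψ p) = p.2 := by
    filter_upwards [e.open_source.mem_nhds (e.map_target hxt)] with p hp
    have := e.left_inv hp
    rw [he] at this
    exact congrArg Prod.snd this
  refine ⟨hU x hxt, fun h0 => ?_, ?_⟩
  · have h1 := hUd.comp (e.symm x)
      ((hec _ (e.map_target hxt)).differentiableAt (by simp)).hasFDerivAt
    have h2 : HasFDerivAt (U ∘ ψ) (ContinuousLinearMap.snd ℝ ℝ ℝ) (e.symm x) :=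
      hasFDerivAt_snd.congr_of_eventuallyEq hUψ
    have h3 := DFunLike.congr_fun (h1.unique h2) (0, 1)
    rw [h0] at h3
    simp at h3
  · rw [hψx, hgx] at hx
    have h1 : HasDerivAt (fun t => U (ψ (t, (e.symm x).2))) (fderiv ℝ U x (v x)) (e.symm x).1 :=
      HasFDerivAt.comp_hasDerivAt (f := fun t => ψ (t, (e.symm x).2)) (e.symm x).1 hUd hx
    refine h1.unique ((hasDerivAt_const _ (e.symm x).2).congr_of_eventuallyEq ?_)
    have h3 : Tendsto (fun t : ℝ => (t, (e.symm x).2)) (𝓝 (e.symm x).1) (𝓝 (e.symm x)) :=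
      Continuous.tendsto' (by fun_prop) _ _ rfl
    exact h3.eventually hUψ

/-! ### The curl as a Jacobian -/

theorem gradient_apply_eq_fderiv_single (U : Plane → ℝ) (x : Plane) (i : Fin 2) :
    ∇ U x i = fderiv ℝ U x (EuclideanSpace.single i 1) := by
  rw [← inner_gradient_left, EuclideanSpace.inner_single_right]
  simp

theorem fderiv_apply_eq_gradient (U : Plane → ℝ) (x w : Plane) :
    fderiv ℝ U x w = ∇ U x 0 * w 0 + ∇ U x 1 * w 1 := by
  rw [← inner_gradient_left, PiLp.inner_apply, Fin.sum_univ_two]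
  simp [mul_comm]

theorem ContDiffAt.gradient {U : Plane → ℝ} {x : Plane} (hU : ContDiffAt ℝ ∞ U x) :
    ContDiffAt ℝ ∞ (∇ U) x :=
  (InnerProductSpace.toDual ℝ Plane).symm.contDiff.contDiffAt.comp x
    (hU.fderiv_right (m := ∞) (by simp))

theorem planeCurl_eq_det {F : Plane → Plane} {U V : Plane → ℝ} {x : Plane}
    (hU : ContDiffAt ℝ ∞ U x) (hV : ContDiffAt ℝ ∞ V x)
    (hF : ∀ᶠ y in 𝓝 x, F y = -(V y • ∇ U y)) :
    planeCurl F x = ∇ U x 0 * ∇ V x 1 - ∇ U x 1 * ∇ V x 0 := by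
  have hn : (∞ : WithTop ℕ∞) ≠ 0 := by simp
  have hd2 := ((hU.fderiv_right (m := ∞) (by simp)).differentiableAt hn).hasFDerivAt
  have hFd : HasFDerivAt F (fderiv ℝ F x) x :=
    (((hV.smul hU.gradient).neg.congr_of_eventuallyEq hF).differentiableAt hn).hasFDerivAt
  have hVd := (hV.differentiableAt hn).hasFDerivAt
  have key : ∀ (i : Fin 2) (w : Plane), fderiv ℝ F x w i =
      -(V x * fderiv ℝ (fderiv ℝ U) x w (EuclideanSpace.single i 1)
        + fderiv ℝ V x w * ∇ U x i) := by
    intro i w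
    have h1 : HasFDerivAt (fun y => F y i) _ x :=
      (EuclideanSpace.proj (𝕜 := ℝ) i).hasFDerivAt.comp x hFd
    have h2 := (hVd.mul (hd2.clm_apply
      (hasFDerivAt_const (EuclideanSpace.single i (1 : ℝ)) x))).neg
    have h3 := h1.unique (h2.congr_of_eventuallyEq (by
      filter_upwards [hF] with y hy
      simp [hy, gradient_apply_eq_fderiv_single]))
    have h4 := DFunLike.congr_fun h3 w
    rw [gradient_apply_eq_fderiv_single]
    simp at h4
    linarith
  -- Symmetry of the second derivative cancels the terms `V · D²U`.
  have hsymm := (hU.isSymmSndFDerivAt (by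
    rw [minSmoothness_of_isRCLikeNormedField]
    exact WithTop.coe_le_coe.2 (le_top (a := (2 : ℕ∞))))) (EuclideanSpace.single 0 1)
    (EuclideanSpace.single 1 1)
  rw [planeCurl, key, key, hsymm, gradient_apply_eq_fderiv_single V,
    gradient_apply_eq_fderiv_single V]
  ring

theorem not_linearIndependent_pair_plane_iff (a b : Plane) :
    ¬ LinearIndependent ℝ ![a, b] ↔ a 0 * b 1 - a 1 * b 0 = 0 := by
  rw [LinearIndependent.pair_iff, not_iff_comm]
  constructor
  · intro hdet s t hst
    have h0 := congrArg (fun z : Plane => z 0) hst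
    have h1 := congrArg (fun z : Plane => z 1) hst
    simp only [PiLp.add_apply, PiLp.smul_apply, PiLp.zero_apply, smul_eq_mul] at h0 h1
    constructor
    · refine (mul_eq_zero.1 (?_ : s * (a 0 * b 1 - a 1 * b 0) = 0)).resolve_right hdet
      linear_combination b 1 * h0 - b 0 * h1
    · refine (mul_eq_zero.1 (?_ : t * (a 0 * b 1 - a 1 * b 0) = 0)).resolve_right hdet
      linear_combination a 0 * h1 - a 1 * h0
  · intro h hdet
    -- Every coordinate of `b i • a - a i • b` is zero or the determinant up to sign, so
    -- independence would force `a = b = 0`.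
    have hb : ∀ i, b i = 0 ∧ -a i = 0 := fun i => h (b i) (-a i) (PiLp.ext fun j => by
      simp only [PiLp.add_apply, PiLp.smul_apply, PiLp.zero_apply, smul_eq_mul]
      fin_cases i <;> fin_cases j <;> simp <;> linarith)
    refine one_ne_zero (h 1 0 (PiLp.ext fun j => ?_)).1
    simpa using (hb j).2

namespace IsGeneralizedPotentials

variable {F : Plane → Plane} {N : Set Plane} {U V : Plane → ℝ}

theorem mono (h : IsGeneralizedPotentials F N U V) {W : Set Plane} (hW : W ⊆ N) :
    IsGeneralizedPotentials F W U V :=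
  ⟨h.smooth_U.mono hW, h.smooth_V.mono hW, fun x hx => h.eq_neg_smul_gradient x (hW hx)⟩

theorem contDiffAt_U (h : IsGeneralizedPotentials F N U V) (hN : IsOpen N) {x : Plane}
    (hx : x ∈ N) : ContDiffAt ℝ ∞ U x :=
  h.smooth_U.contDiffAt (hN.mem_nhds hx)

theorem contDiffAt_V (h : IsGeneralizedPotentials F N U V) (hN : IsOpen N) {x : Plane}
    (hx : x ∈ N) : ContDiffAt ℝ ∞ V x :=
  h.smooth_V.contDiffAt (hN.mem_nhds hx)

theorem planeCurl_eq (h : IsGeneralizedPotentials F N U V) (hN : IsOpen N) {x : Plane}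
    (hx : x ∈ N) : planeCurl F x = ∇ U x 0 * ∇ V x 1 - ∇ U x 1 * ∇ V x 0 :=
  planeCurl_eq_det (h.contDiffAt_U hN hx) (h.contDiffAt_V hN hx)
    (Filter.mem_of_superset (hN.mem_nhds hx) h.eq_neg_smul_gradient)

theorem planeCurl_eq_zero_of_gradient_eq_zero (h : IsGeneralizedPotentials F N U V)
    (hN : IsOpen N) (hV : ∀ x ∈ N, ∇ V x = 0) : ∀ x ∈ N, planeCurl F x = 0 := by
  intro x hx
  simp [h.planeCurl_eq hN hx, hV x hx]

/-- If `V` is a function of `U` then the image of `(U, V)` lies in a graph, so that `(U, V)` is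
nowhere a submersion. -/
theorem planeCurl_eq_zero_of_eq_comp (h : IsGeneralizedPotentials F N U V)
    (hN : IsOpen N) {f : ℝ → ℝ} (hf : ∀ x ∈ N, V x = f (U x)) : ∀ x ∈ N, planeCurl F x = 0 := by
  intro x hx
  rw [h.planeCurl_eq hN hx]
  by_contra hdet
  have hn : (∞ : WithTop ℕ∞) ≠ 0 := by simp
  have hd := ((h.contDiffAt_U hN hx).hasStrictFDerivAt hn).prodMk
    ((h.contDiffAt_V hN hx).hasStrictFDerivAt hn)
  obtain ⟨e, he⟩ := ((fderiv ℝ U x).prod (fderiv ℝ V x)).exists_equiv_of_injective (by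
    intro w hw
    have h0 := congrArg Prod.fst hw
    have h1 := congrArg Prod.snd hw
    simp only [ContinuousLinearMap.prod_apply, fderiv_apply_eq_gradient, Prod.fst_zero,
      Prod.snd_zero] at h0 h1
    have hw0 : w 0 = 0 := by
      refine (mul_eq_zero.1 (?_ : w 0 * _ = 0)).resolve_right hdet
      linear_combination ∇ V x 1 * h0 - ∇ U x 1 * h1
    have hw1 : w 1 = 0 := by
      refine (mul_eq_zero.1 (?_ : w 1 * _ = 0)).resolve_right hdet
      linear_combination ∇ U x 0 * h1 - ∇ V x 0 * h0
    refine PiLp.ext fun i => ?_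
    fin_cases i
    · exact hw0
    · exact hw1) (by simp)
  -- Full rank makes `(U, V)` open at `x`, so the graph of `f` would contain a neighbourhood of `(U
  -- x, V x)`; but it meets a vertical line only once.
  have hmap := hd.map_nhds_eq_of_surj (LinearMap.range_eq_top.2 (by
    rw [← he]; exact e.surjective))
  have hgraph : ∀ᶠ q in 𝓝 (U x, V x), q.2 = f q.1 := by
    rw [← hmap, eventually_map]
    exact Filter.mem_of_superset (hN.mem_nhds hx) hf
  have hline : ∀ᶠ s in 𝓝 (V x), s = V x := by
    have h1 : Tendsto (fun s : ℝ => (U x, s)) (𝓝 (V x)) (𝓝 (U x, V x)) :=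
      Continuous.tendsto' (by fun_prop) _ _ rfl
    filter_upwards [h1.eventually hgraph] with s hs
    rw [hf x hx]
    exact hs
  obtain ⟨s, hs, hs'⟩ := ((hline.filter_mono nhdsWithin_le_nhds).and
    (self_mem_nhdsWithin : {V x}ᶜ ∈ 𝓝[≠] (V x))).exists
  exact hs' hs

end IsGeneralizedPotentials

/-! ### Functional dependence -/

theorem fderiv_apply_eq_zero_of_det_eq_zero {U V : Plane → ℝ} {x w : Plane}
    (hdet : ∇ U x 0 * ∇ V x 1 - ∇ U x 1 * ∇ V x 0 = 0) (hU : ∇ U x ≠ 0)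
    (hw : fderiv ℝ U x w = 0) : fderiv ℝ V x w = 0 := by
  rw [fderiv_apply_eq_gradient] at hw ⊢
  have hpos := (sq_add_sq_pos_of_ne_zero hU).ne'
  -- Expand `w` in the orthogonal basis formed by `∇U` and its rotation: the first component is
  -- `dU(w)`, and the second pairs with `∇V` to the determinant.
  refine (mul_eq_zero.1 (?_ : _ * (∇ U x 0 ^ 2 + ∇ U x 1 ^ 2) = 0)).resolve_right hpos
  linear_combination (∇ U x 0 * ∇ V x 0 + ∇ U x 1 * ∇ V x 1) * hw +
    (∇ U x 0 * w 1 - ∇ U x 1 * w 0) * hdet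

/-- Where two functions of the plane have everywhere parallel gradients, the second one is locally
a smooth function of the first near every regular point of the first. -/
theorem exists_contDiff_comp_of_det_eq_zero {U V : Plane → ℝ} {p : Plane}
    (hU : ∀ᶠ x in 𝓝 p, ContDiffAt ℝ ∞ U x) (hV : ∀ᶠ x in 𝓝 p, ContDiffAt ℝ ∞ V x)
    (hp : ∇ U p ≠ 0) (hdet : ∀ᶠ x in 𝓝 p, ∇ U x 0 * ∇ V x 1 - ∇ U x 1 * ∇ V x 0 = 0) :
    ∃ f : ℝ → ℝ, ContDiff ℝ ∞ f ∧ ∀ᶠ x in 𝓝 p, V x = f (U x) := by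
  have hn : (∞ : WithTop ℕ∞) ≠ 0 := by simp
  -- Pairing with the rotated gradient: `(dU, ℓ)` has determinant `|∇U|²` at `p`.
  let ℓ : Plane →L[ℝ] ℝ := ∇ U p 0 • EuclideanSpace.proj 1 - ∇ U p 1 • EuclideanSpace.proj 0
  have hℓ : ∀ w, ℓ w = ∇ U p 0 * w 1 - ∇ U p 1 * w 0 := fun w => rfl
  let H : Plane → ℝ × ℝ := fun x => (U x, ℓ x)
  have hH : ∀ᶠ x in 𝓝 p, ContDiffAt ℝ ∞ H x := hU.mono fun x hx => hx.prodMk ℓ.contDiff.contDiffAt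
  have hHd : HasFDerivAt H ((fderiv ℝ U p).prod ℓ) p :=
    (hU.self_of_nhds.differentiableAt hn).hasFDerivAt.prodMk ℓ.hasFDerivAt
  obtain ⟨H', hH'⟩ := ((fderiv ℝ U p).prod ℓ).exists_equiv_of_injective (by
    intro w hw
    have h0 := congrArg Prod.fst hw
    have h1 := congrArg Prod.snd hw
    simp only [ContinuousLinearMap.prod_apply, fderiv_apply_eq_gradient, hℓ, Prod.fst_zero,
      Prod.snd_zero] at h0 h1
    have hpos := (sq_add_sq_pos_of_ne_zero hp).ne'
    have hw0 : w 0 = 0 := by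
      refine (mul_eq_zero.1 (?_ : w 0 * _ = 0)).resolve_right hpos
      linear_combination ∇ U p 0 * h0 - ∇ U p 1 * h1
    have hw1 : w 1 = 0 := by
      refine (mul_eq_zero.1 (?_ : w 1 * _ = 0)).resolve_right hpos
      linear_combination ∇ U p 0 * h1 + ∇ U p 1 * h0
    refine PiLp.ext fun i => ?_
    fin_cases i
    · exact hw0
    · exact hw1) (by simp)
  obtain ⟨e, he, hpe, -, hes⟩ := exists_openPartialHomeomorph_contDiffAt hH (f' := H')
    (by rw [hH']; exact hHd)
  have hpt : H p ∈ e.target := by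
    have := e.map_source hpe
    rwa [he] at this
  have hsymm : e.symm (H p) = p := by
    have := e.left_inv hpe
    rwa [he] at this
  have hgrad : ∀ᶠ x in 𝓝 p, ∇ U x ≠ 0 :=
    hU.self_of_nhds.gradient.continuousAt.eventually_ne hp
  have htend : Tendsto e.symm (𝓝 (H p)) (𝓝 p) := by
    have := (hes _ hpt).continuousAt
    rwa [ContinuousAt, hsymm] at this
  obtain ⟨r, hr, hball⟩ := Metric.eventually_nhds_iff_ball.1
    ((e.open_target.eventually_mem hpt).and
      (htend.eventually (hU.and (hV.and (hgrad.and hdet)))))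
  have hmem : ∀ {u l : ℝ}, (u, l) ∈ Metric.ball (H p) r ↔
      u ∈ Metric.ball (U p) r ∧ l ∈ Metric.ball (ℓ p) r := by
    intro u l
    simp [Prod.dist_eq, H]
  have hsmooth : ∀ q ∈ Metric.ball (H p) r, ContDiffAt ℝ ∞ (fun q => V (e.symm q)) q :=
    fun q hq => (hball q hq).2.2.1.comp q (hes q (hball q hq).1)
  -- Moving `l` stays in a level set of `U`, so the velocity is in the kernel of `dU`, hence of
  -- `dV`.
  have hder : ∀ {u l : ℝ}, (u, l) ∈ Metric.ball (H p) r →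
      HasDerivAt (fun l => V (e.symm (u, l))) 0 l := by
    intro u l hq
    obtain ⟨hqt, hqU, hqV, hqg, hqd⟩ := hball _ hq
    have h1 : HasDerivAt (fun l : ℝ => (u, l)) (0, 1) l :=
      (hasDerivAt_const l u).prodMk (hasDerivAt_id l)
    have h2 := HasFDerivAt.comp_hasDerivAt (f := fun l : ℝ => (u, l)) l
      ((hes _ hqt).differentiableAt hn).hasFDerivAt h1
    have h3 := HasFDerivAt.comp_hasDerivAt (f := e.symm ∘ fun l : ℝ => (u, l)) l
      (hqU.differentiableAt hn).hasFDerivAt h2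
    have h4 := HasFDerivAt.comp_hasDerivAt (f := e.symm ∘ fun l : ℝ => (u, l)) l
      (hqV.differentiableAt hn).hasFDerivAt h2
    have h5 : ∀ᶠ l' in 𝓝 l, U (e.symm (u, l')) = u := by
      have ht : Tendsto (fun l : ℝ => (u, l)) (𝓝 l) (𝓝 (u, l)) :=
        Continuous.tendsto' (by fun_prop) _ _ rfl
      filter_upwards [ht.eventually (e.open_target.mem_nhds hqt)] with l' hl'
      have := e.right_inv hl'
      rw [he] at this
      exact congrArg Prod.fst this
    have h6 := h3.unique ((hasDerivAt_const l u).congr_of_eventuallyEq h5)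
    have h7 := fderiv_apply_eq_zero_of_det_eq_zero hqd hqg h6
    rw [h7] at h4
    exact h4
  have hconst : ∀ {u l : ℝ}, (u, l) ∈ Metric.ball (H p) r →
      V (e.symm (u, l)) = V (e.symm (u, ℓ p)) := by
    intro u l hq
    have h1 := (convex_ball (ℓ p) r).norm_image_sub_le_of_norm_hasDerivWithin_le
      (f := fun l => V (e.symm (u, l))) (f' := fun _ => 0) (C := 0)
      (fun l' hl' => (hder (hmem.2 ⟨(hmem.1 hq).1, hl'⟩)).hasDerivWithinAt) (by simp)
      (Metric.mem_ball_self hr) (hmem.1 hq).2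
    rw [zero_mul, norm_le_zero_iff, sub_eq_zero] at h1
    exact h1
  obtain ⟨f, hf, hfe⟩ := exists_contDiff_eventuallyEq
    (f := fun u => V (e.symm (u, ℓ p))) (x₀ := U p) (by
      filter_upwards [Metric.ball_mem_nhds (U p) hr] with u hu
      exact ContDiffAt.comp (f := fun u => (u, ℓ p)) u
        (hsmooth (u, ℓ p) (hmem.2 ⟨hu, Metric.mem_ball_self hr⟩))
        (contDiffAt_id.prodMk contDiffAt_const))
  refine ⟨f, hf, ?_⟩
  filter_upwards [hU.self_of_nhds.continuousAt.eventually hfe, e.open_source.mem_nhds hpe,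
    hH.self_of_nhds.continuousAt.eventually (Metric.ball_mem_nhds _ hr)] with x hx hxs hxb
  have h1 := e.left_inv hxs
  rw [he] at h1
  rw [hx, ← hconst hxb]
  exact congrArg V h1.symm

/-! ### Existence of generalized potentials -/

theorem fderiv_eq_zero_iff_gradient_eq_zero (U : Plane → ℝ) (x : Plane) :
    fderiv ℝ U x = 0 ↔ ∇ U x = 0 := by
  simp [gradient]

/-- The Poincaré lemma for plane vector fields. -/
theorem exists_isGeneralizedPotentials_of_planeCurl_eq_zero {D : Set Plane} (hD : IsOpen D)
    (hconv : Convex ℝ D) {F : Plane → Plane} (hF : ContDiffOn ℝ ∞ F D)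
    (hcurl : ∀ x ∈ D, planeCurl F x = 0) :
    ∃ U : Plane → ℝ, IsGeneralizedPotentials F D U (fun _ => 1) := by
  have hn : (∞ : WithTop ℕ∞) ≠ 0 := by simp
  -- With `V = 1`, the differential of `U` must be this form; zero curl is the symmetry of its
  -- derivative.
  let α : Plane → Plane →L[ℝ] ℝ := fun x => innerSL ℝ (-F x)
  have hαs : ContDiffOn ℝ ∞ α D := (innerSL ℝ (E := Plane)).contDiff.comp_contDiffOn hF.neg
  have hα : ∀ a ∈ D, ∀ x y, fderiv ℝ α a x y = fderiv ℝ α a y x := by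
    intro a ha
    have hFd := ((hF.contDiffAt (hD.mem_nhds ha)).differentiableAt hn).hasFDerivAt
    have h1 : HasFDerivAt α ((innerSL ℝ (E := Plane)) ∘L (-fderiv ℝ F a)) a :=
      (innerSL ℝ (E := Plane)).hasFDerivAt.comp a hFd.neg
    intro x y
    have hbasis : ∀ w : Plane, w = w 0 • EuclideanSpace.single 0 (1 : ℝ) +
        w 1 • EuclideanSpace.single 1 (1 : ℝ) := by
      intro w
      refine PiLp.ext fun i => ?_
      fin_cases i <;> simp
    have h2 : ∀ w i, fderiv ℝ F a w i = w 0 * fderiv ℝ F a (EuclideanSpace.single 0 1) i +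
        w 1 * fderiv ℝ F a (EuclideanSpace.single 1 1) i := by
      intro w i
      conv_lhs => rw [hbasis w]
      simp
    have h3 : ∀ u w, fderiv ℝ α a u w = -(fderiv ℝ F a u 0 * w 0 + fderiv ℝ F a u 1 * w 1) := by
      intro u w
      rw [h1.fderiv]
      change inner ℝ (-fderiv ℝ F a u) w = _
      rw [inner_neg_left, PiLp.inner_apply, Fin.sum_univ_two]
      simp [mul_comm]
    have h4 : fderiv ℝ F a (EuclideanSpace.single 0 1) 1 -
      fderiv ℝ F a (EuclideanSpace.single 1 1) 0 = 0 := hcurl a ha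
    rw [h3, h3, h2 x 0, h2 x 1, h2 y 0, h2 y 1]
    linear_combination (x 1 * y 0 - x 0 * y 1) * h4
  obtain ⟨U, hU⟩ := hconv.exists_forall_hasFDerivAt_of_fderiv_symmetric hD
    (hαs.differentiableOn hn) hα
  refine ⟨U, ?_, contDiffOn_const, fun x hx => ?_⟩
  · rw [contDiffOn_infty_iff_fderiv_of_isOpen hD]
    exact ⟨fun x hx => (hU x hx).differentiableAt.differentiableWithinAt,
      hαs.congr fun x hx => (hU x hx).fderiv⟩
  · refine PiLp.ext fun i => ?_
    rw [PiLp.neg_apply, PiLp.smul_apply, gradient_apply_eq_fderiv_single, (hU x hx).fderiv]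
    simp [α, EuclideanSpace.inner_single_right]

/-- A smooth plane vector field has generalized potentials near every point at which it does not
vanish. -/
theorem exists_isGeneralizedPotentials_of_ne_zero {F : Plane → Plane} {x₀ : Plane}
    (hF : ∀ᶠ x in 𝓝 x₀, ContDiffAt ℝ ∞ F x) (h0 : F x₀ ≠ 0) :
    ∃ U V : Plane → ℝ, ∃ N ∈ 𝓝 x₀, IsGeneralizedPotentials F N U V := by
  obtain ⟨U, hU⟩ := exists_first_integral (v := fun x => planeRotate (F x))
    (hF.mono fun x hx => contDiff_planeRotate.contDiffAt.comp x hx) (planeRotate_ne_zero h0)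
  let S : Plane → ℝ := fun x => ∇ U x 0 ^ 2 + ∇ U x 1 ^ 2
  have hcoord : ∀ {G : Plane → Plane} {x}, ContDiffAt ℝ ∞ G x → ∀ i,
      ContDiffAt ℝ ∞ (fun y => G y i) x := fun hG i => contDiffAt_euclidean.1 hG i
  -- As `F` is parallel to `∇U`, minus its coefficient along `∇U` is the required `V`.
  refine ⟨U, fun x => -(F x 0 * ∇ U x 0 + F x 1 * ∇ U x 1) / S x, _, hF.and hU,
    fun x hx => hx.2.1.contDiffWithinAt, fun x hx => ?_, fun x hx => ?_⟩
  all_goals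
    obtain ⟨hFx, hUx, hdU, hrot⟩ := hx
    have hg : ∇ U x ≠ 0 := fun h => hdU ((fderiv_eq_zero_iff_gradient_eq_zero U x).2 h)
    have hpos : S x ≠ 0 := (sq_add_sq_pos_of_ne_zero hg).ne'
  · refine ContDiffAt.contDiffWithinAt (ContDiffAt.div ?_ ?_ hpos)
    · exact (((hcoord hFx 0).mul (hcoord hUx.gradient 0)).add
        ((hcoord hFx 1).mul (hcoord hUx.gradient 1))).neg
    · exact ((hcoord hUx.gradient 0).pow 2).add ((hcoord hUx.gradient 1).pow 2)
  · rw [fderiv_apply_eq_gradient, planeRotate_zero, planeRotate_one] at hrot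
    refine PiLp.ext fun i => ?_
    rw [PiLp.neg_apply, PiLp.smul_apply, smul_eq_mul]
    field_simp
    simp only [S]
    fin_cases i
    · simp only [Fin.zero_eta]
      linear_combination ∇ U x 1 * hrot
    · simp only [Fin.mk_one]
      linear_combination -∇ U x 0 * hrot

/-! ### The theorem -/

theorem mainTheorem1 (D : Set Plane) (hD : IsOpen D)
    (F : Plane → Plane) (hF : ContDiffOn ℝ ∞ F D) :
    (∀ x₀ ∈ D, (F x₀ ≠ 0 ∨ ∀ᶠ x in 𝓝 x₀, planeCurl F x = 0) →
      ∃ (N : Set Plane) (U V : Plane → ℝ), IsOpen N ∧ x₀ ∈ N ∧ N ⊆ D ∧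
        IsGeneralizedPotentials F N U V ∧
        ∀ W : Set Plane, IsOpen W → x₀ ∈ W → W ⊆ N →
          ((∀ x ∈ W, planeCurl F x = 0) ↔ ∀ x ∈ W, ∇ V x = 0) ∧
          ((∀ x ∈ W, planeCurl F x = 0) ↔ ∃ f : ℝ → ℝ, ∀ x ∈ W, V x = f (U x))) ∧
    (∀ (N : Set Plane) (U V : Plane → ℝ), IsOpen N → N ⊆ D →
      IsGeneralizedPotentials F N U V →
        (∀ x ∈ N, planeCurl F x = 0 ↔ ¬ LinearIndependent ℝ ![∇ U x, ∇ V x]) ∧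
        ((∀ x ∈ N, ∇ V x = 0) → ∀ x ∈ N, planeCurl F x = 0) ∧
        ((∃ f : ℝ → ℝ, ∀ x ∈ N, V x = f (U x)) → ∀ x ∈ N, planeCurl F x = 0) ∧
        (∀ p ∈ N, ∇ U p ≠ 0 →
          ((∀ᶠ x in 𝓝 p, planeCurl F x = 0) ↔
            ∃ f : ℝ → ℝ, ContDiff ℝ ∞ f ∧ ∀ᶠ x in 𝓝 p, V x = f (U x)))) := by
  refine ⟨fun x₀ hx₀ hx₀' => ?_, fun N U V hN _ h => ⟨fun x hx => ?_,
    h.planeCurl_eq_zero_of_gradient_eq_zero hN, fun ⟨f, hf⟩ => h.planeCurl_eq_zero_of_eq_comp hN hf,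
    fun p hp hUp => ⟨fun hcurl => ?_, fun ⟨f, _, hf⟩ => ?_⟩⟩⟩
  -- The split is on the curl, even when `F x₀ ≠ 0`: potentials with nonconstant `V` could break the
  -- first equivalence where the curl vanishes.
  · by_cases hcurl : ∀ᶠ x in 𝓝 x₀, planeCurl F x = 0
    · obtain ⟨r, hr, hball⟩ := Metric.eventually_nhds_iff_ball.1
        (hcurl.and (hD.eventually_mem hx₀))
      obtain ⟨U, hU⟩ := exists_isGeneralizedPotentials_of_planeCurl_eq_zero
        (Metric.isOpen_ball (x := x₀) (ε := r)) (convex_ball x₀ r)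
        (hF.mono fun x hx => (hball x hx).2) (fun x hx => (hball x hx).1)
      refine ⟨Metric.ball x₀ r, U, fun _ => 1, Metric.isOpen_ball, Metric.mem_ball_self hr,
        fun x hx => (hball x hx).2, hU, fun W _ _ hWN => ?_⟩
      have hW : ∀ x ∈ W, planeCurl F x = 0 := fun x hx => (hball x (hWN hx)).1
      exact ⟨iff_of_true hW fun x _ => by simp [gradient],
        iff_of_true hW ⟨fun _ => 1, fun _ _ => rfl⟩⟩
    · obtain ⟨U, V, N', hN', hUV⟩ := exists_isGeneralizedPotentials_of_ne_zero
        ((hD.eventually_mem hx₀).mono fun x hx => hF.contDiffAt (hD.mem_nhds hx))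
        (hx₀'.resolve_right hcurl)
      obtain ⟨N, hNsub, hN, hxN⟩ := mem_nhds_iff.1 (inter_mem hN' (hD.mem_nhds hx₀))
      have h := hUV.mono fun x hx => (hNsub hx).1
      refine ⟨N, U, V, hN, hxN, fun x hx => (hNsub hx).2, h, fun W hW hxW hWN => ?_⟩
      have hne : ¬ ∀ x ∈ W, planeCurl F x = 0 := fun hc =>
        hcurl (Filter.mem_of_superset (hW.mem_nhds hxW) hc)
      exact ⟨iff_of_false hne fun hV =>
          hne ((h.mono hWN).planeCurl_eq_zero_of_gradient_eq_zero hW hV),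
        iff_of_false hne fun ⟨f, hf⟩ => hne ((h.mono hWN).planeCurl_eq_zero_of_eq_comp hW hf)⟩
  · rw [not_linearIndependent_pair_plane_iff, h.planeCurl_eq hN hx]
  · have hmem := hN.eventually_mem hp
    refine exists_contDiff_comp_of_det_eq_zero (hmem.mono fun x hx => h.contDiffAt_U hN hx)
      (hmem.mono fun x hx => h.contDiffAt_V hN hx) hUp ?_
    filter_upwards [hmem, hcurl] with x hx hc
    rw [← h.planeCurl_eq hN hx, hc]
  · obtain ⟨W, hWsub, hW, hpW⟩ := mem_nhds_iff.1 (hf.and (hN.eventually_mem hp))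
    exact Filter.mem_of_superset (hW.mem_nhds hpW)
      ((h.mono fun x hx => (hWsub hx).2).planeCurl_eq_zero_of_eq_comp hW fun x hx => (hWsub hx).1)
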